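/- Let $I=[0,1]$ or $I=[0,\infty)$, and let $\Pr$ be Wiener measure on the space $C(I)$ of continuous functions $I\to\mathbb R$ (with the topology of uniform convergence on compact sets), i.e. the law of standard one-dimensional Brownian motion started at $0$. For a piecewise linear function $p$ that interpolates between finitely many points with rational coordinates, a rational $r>0$ and an integer $N\ge 1$, let $O_{p,r,N}=\{f\in C(I) : |f(t)-p(t)|<r \text{ for all } t\in I\cap[0,N]\}$ (for $I=[0,1]$ these are the sup-norm balls $\|f-p\|_\infty<r$). A Martin-Löf test is a sequence $(\mathcal U_n)_{n\ge 0}$ of subsets of $C(I)$, each a union of sets $O_{p,r,N}$ whose codes are recursively enumerable uniformly in $n$, with $\Pr(\mathcal U_n)\le 2^{-n}$ for all $n$. A path $B\in C(I)$ is Martin-Löf random if $B\notin\bigcap_n\mathcal U_n$ for every Martin-Löf test $(\mathcal U_n)_n$. Let $K$ denote prefix-free Kolmogorov complexity of finite binary strings (with respect to any fixed optimal prefix-free machine). The effective Hausdorff dimension of an infinite binary sequence $X$ is $$\mathrm{cdim}(X)=\liminf_{n\to\infty}\frac{K(X\upharpoonright n)}{n},$$ and the effective Hausdorff dimension $\mathrm{cdim}(x)$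 of a real $x\ge 0$ is that of the sequence of binary digits of its fractional part. Theorem. If $B$ is a Martin-Löf random path and $Z_B=\{t\in I : B(t)=0\}$ is its zero set, then $\mathrm{cdim}(t)\ge \tfrac12$ for every $t\in Z_B\setminus\{0\}$. -/

import Mathlib

open MeasureTheory ProbabilityTheory Filter
open scoped NNReal ENNReal

noncomputable section

namespace MLBrownian

/-! ### Path space and Wiener measure -/

/-- Spaces of continuous real functions carry the Borel `σ`-algebra of the topology of uniform
convergence on compact sets (the sup-norm topology when the domain is compact). -/
instance pathMeasurableSpace {X : Type*} [TopologicalSpace X] : MeasurableSpace C(X, ℝ) :=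
  borel _

instance pathBorelSpace {X : Type*} [TopologicalSpace X] : BorelSpace C(X, ℝ) :=
  ⟨rfl⟩

/-- Wiener measure on `C(I, ℝ)`: the law of standard Brownian motion with time set `I`. Under `μ`
the coordinate process starts at `0`, has independent increments, and `f t - f s` is normal with
mean `0` and variance `t - s` whenever `s ≤ t`. -/
structure IsWienerMeasure {I : Set ℝ≥0} (μ : Measure C(I, ℝ)) : Prop where
  isProbabilityMeasure : IsProbabilityMeasure μ
  eval_zero : ∀ t : I, (t : ℝ≥0) = 0 → ∀ᵐ f ∂μ, f t = 0
  indep_increments : HasIndepIncrements (fun (t : I) (f : C(I, ℝ)) => f t) μ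
  law_increment : ∀ s t : I, s ≤ t →
    HasLaw (fun f : C(I, ℝ) => f t - f s) (gaussianReal 0 ((t : ℝ≥0) - (s : ℝ≥0))) μ

/-! ### Effectively open sets and Martin-Löf randomness -/

/-- The piecewise linear function whose graph interpolates between the points
`(k / (m + 1), v k / (d + 1))`, `k = 0, 1, …`, where `v k = 0` once `k` exceeds the length of the
list `v`. As `m`, `d` and `v` vary, the restrictions to `[0, N]` of these functions are exactly the
piecewise linear functions on `[0, N]` interpolating between finitely many points with rational
coordinates. -/
def interpolant (m d : ℕ) (v : List ℤ) (t : ℝ) : ℝ :=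
  ∑ k : Fin v.length, ((v.get k : ℝ) / ((d : ℝ) + 1)) * max 0 (1 - |((m : ℝ) + 1) * t - (k : ℕ)|)

/-- Finite codes `(N, m, d, j, v)` for basic open sets of paths. -/
abbrev BallCode : Type := ℕ × ℕ × ℕ × ℕ × List ℤ

/-- The basic open set coded by `(N, m, d, j, v)`: all paths whose distance from the rational
piecewise linear function `interpolant m d v` is less than the rational number
`(j + 1) / (d + 1)`, uniformly on `I ∩ [0, N + 1]`.
For `I = [0, 1]` these are exactly the sup-norm balls of positive rational radius around rational
piecewise linear functions; for `I = [0, ∞)` they are the balls for the sup-seminorms on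
`[0, N + 1]`. -/
def basicOpen (I : Set ℝ≥0) : BallCode → Set C(I, ℝ)
  | (N, m, d, j, v) =>
    {f | ∀ t : I, (t : ℝ≥0) ≤ (N : ℝ≥0) + 1 →
      |f t - interpolant m d v ((t : ℝ≥0) : ℝ)| < ((j : ℝ) + 1) / ((d : ℝ) + 1)}

/-- A sequence of sets of paths that is uniformly effectively open (uniformly `Σ⁰₁`): the `n`-th
set is the union of the basic open sets whose codes `c` satisfy `W (n, c)`, for a single
recursively enumerable relation `W`. -/
def UniformlyEffectivelyOpen {I : Set ℝ≥0} (U : ℕ → Set C(I, ℝ)) : Prop :=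
  ∃ W : ℕ × BallCode → Prop, REPred W ∧
    ∀ n, U n = {f | ∃ c : BallCode, W (n, c) ∧ f ∈ basicOpen I c}

/-- Martin-Löf tests with respect to the measure `μ`. -/
structure IsMLTest {I : Set ℝ≥0} (μ : Measure C(I, ℝ)) (U : ℕ → Set C(I, ℝ)) : Prop where
  effectivelyOpen : UniformlyEffectivelyOpen U
  measure_le : ∀ n, μ (U n) ≤ (2⁻¹ : ℝ≥0∞) ^ n

/-- A path is Martin-Löf random for `μ` if no Martin-Löf test captures it. -/
def IsMLRandom {I : Set ℝ≥0} (μ : Measure C(I, ℝ)) (B : C(I, ℝ)) : Prop :=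
  ∀ U : ℕ → Set C(I, ℝ), IsMLTest μ U → B ∉ ⋂ n, U n

/-- The zero set `{t : B t = 0}` of a path. -/
def zeroSet {I : Set ℝ≥0} (B : C(I, ℝ)) : Set ℝ≥0 :=
  {t | ∃ h : t ∈ I, B ⟨t, h⟩ = 0}

/-! ### Prefix-free complexity and effective Hausdorff dimension -/

/-- A prefix-free machine: a partial computable function on finite binary strings such that no
string in its domain is a proper prefix of another string in its domain. -/
structure IsPrefixFreeMachine (M : List Bool →. List Bool) : Prop where
  partrec : Partrec M
  prefixFree : ∀ σ τ : List Bool, (M σ).Dom → (M τ).Dom → σ <+: τ → σ = τ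

/-- The length of a shortest `M`-program for `σ` (and `⊤` if there is none). -/
def complexity (M : List Bool →. List Bool) (σ : List Bool) : ℕ∞ :=
  ⨅ (p : List Bool) (_ : σ ∈ M p), (p.length : ℕ∞)

/-- Optimal prefix-free machines, that is, the reference machines `U` for which prefix-free
Kolmogorov complexity is `K = complexity U`. -/
structure IsOptimalPrefixFreeMachine (U : List Bool →. List Bool) : Prop
    extends IsPrefixFreeMachine U where
  optimal : ∀ M : List Bool →. List Bool, IsPrefixFreeMachine M →
    ∃ c : ℕ, ∀ σ : List Bool, complexity U σ ≤ complexity M σ + c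

/-- The effective Hausdorff dimension `liminf K(X ↾ n) / n` of an infinite binary sequence, where
`K` is the complexity with respect to the reference machine `U`. -/
def seqEffDim (U : List Bool →. List Bool) (X : ℕ → Bool) : ℝ≥0∞ :=
  liminf (fun n : ℕ => (complexity U ((List.range n).map X) : ℝ≥0∞) / (n : ℝ≥0∞)) atTop

/-- The binary digits of `x` after the binary point: `binaryDigits x i` is the digit of
weight `2 ^ (-(i + 1))`. -/
def binaryDigits (x : ℝ) (i : ℕ) : Bool :=
  decide (⌊x * 2 ^ (i + 1)⌋ % 2 = 1)

/-- The effective Hausdorff dimension of a real number, identified with its binary representation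
(the finitely many digits in front of the binary point play no role). -/
def effDim (U : List Bool →. List Bool) (x : ℝ) : ℝ≥0∞ :=
  seqEffDim U (binaryDigits x)

end MLBrownian

end

noncomputable section

namespace MLBrownian

/-! ### Recursively enumerable predicates -/

section RE

variable {α β : Type*} [Primcodable α] [Primcodable β]

/-! Suppose `B t = 0` with `t ≠ 0` and the dimension of `t` is below `1/2`. Two facts about the path
on the grid of mesh `4⁻ⁱ`, where `i = n / 2`, then contradict each other.

Near a zero the path is small. Increments from a grid of mesh `4⁻ᵐ` to the next finer one have
standard deviation at most `2⁻ᵐ`, and for a random path they are eventually bounded by `(m + 1) / 2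
^ m`. Summing these bounds along the grid points below `t` gives a value of at most `(2 * i + 4) / 2
^ i` at the last grid point before `t` (`abs_pathVal_gridFloor_le`).

Simple times avoid small values. For some `q` and infinitely many `n`, the first `n` digits of `t`
have a program of length at most `(1/2 - 1/q) n`, and with the integer part they determine that grid
point. At a fixed time bounded away from `0` the Gaussian density is bounded, so a value this small
has probability `O(n 2^(-n/2))`. The union over all such programs has probability `O(n 2^(-n/q))`
(`exists_measure_smallValueEvent_le`).

Both families of exceptional events are uniformly effectively open with geometrically decreasing
measure, so a random path lies in only finitely many of them (`IsMLRandom.exists_forall_notMem`). -/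

theorem rePred_of_primrecPred {p : α × ℕ → Prop} (hp : PrimrecPred p) :
    REPred fun a => ∃ k, p (a, k) := by
  obtain ⟨_, hp'⟩ := hp
  have h : Partrec fun a : α => Nat.rfind fun k => Part.some (decide (p (a, k))) :=
    Partrec.rfind (hp'.to_comp.of_eq fun _ => rfl).partrec
  refine h.dom_re.of_eq fun a => ?_
  refine (Nat.rfind_dom (p := fun k => Part.some (decide (p (a, k))))).trans ?_
  exact ⟨fun ⟨k, hk, _⟩ => ⟨k, by simpa using (Part.mem_some_iff.1 hk).symm⟩,
    fun ⟨k, hk⟩ => ⟨k, by simpa using hk, fun _ => trivial⟩⟩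

theorem exists_primrecPred_of_rePred {p : α → Prop} (hp : REPred p) :
    ∃ q : α × ℕ → Prop, PrimrecPred q ∧ ∀ a, p a ↔ ∃ k, q (a, k) := by
  obtain ⟨c, hc⟩ := Nat.Partrec.Code.exists_code.1 hp
  refine ⟨fun x => (Nat.Partrec.Code.evaln x.2 c (Encodable.encode x.1)).isSome, ?_, fun a => ?_⟩
  · refine ⟨inferInstance, ?_⟩
    have := Primrec.option_isSome.comp (Nat.Partrec.Code.primrec_evaln.comp
      ((Primrec.snd.pair (Primrec.const c)).pair (Primrec.encode.comp Primrec.fst)) :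
      Primrec fun x : α × ℕ => Nat.Partrec.Code.evaln x.2 c (Encodable.encode x.1))
    exact this.of_eq fun x => by simp
  · have h1 : p a ↔ (Nat.Partrec.Code.eval c (Encodable.encode a)).Dom := by
      rw [hc]; simp [Part.assert]
    rw [h1, Part.dom_iff_mem]
    simp only [Nat.Partrec.Code.evaln_complete, Option.isSome_iff_exists, Option.mem_def]
    exact exists_comm

theorem rePred_comp {p : β → Prop} (hp : REPred p) {f : α → β} (hf : Computable f) :
    REPred fun a => p (f a) :=
  Partrec.comp hp hf

theorem rePred_and {p q : α → Prop} (hp : REPred p) (hq : PrimrecPred q) :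
    REPred fun a => p a ∧ q a := by
  obtain ⟨r, hr, hpr⟩ := exists_primrecPred_of_rePred hp
  refine (rePred_of_primrecPred (hr.and (hq.comp Primrec.fst))).of_eq fun a => ?_
  simp [hpr]

/-- Dovetailing: one number codes both a candidate `b` and the stage at which `p (a, b)` is
confirmed. -/
theorem rePred_exists {p : α × β → Prop} (hp : REPred p) : REPred fun a => ∃ b, p (a, b) := by
  obtain ⟨r, ⟨_, hr⟩, hpr⟩ := exists_primrecPred_of_rePred hp
  have h : Primrec fun x : α × ℕ => ((Encodable.decode (α := β) x.2.unpair.1).map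
      fun b => decide (r ((x.1, b), x.2.unpair.2))).getD false := by
    refine Primrec.option_getD.comp (Primrec.option_map
      (Primrec.decode.comp (Primrec.fst.comp (Primrec.unpair.comp Primrec.snd))) ?_)
      (Primrec.const false)
    exact hr.comp (((Primrec.fst.comp Primrec.fst).pair Primrec.snd).pair
      (Primrec.snd.comp (Primrec.unpair.comp (Primrec.snd.comp Primrec.fst))))
  have h' : PrimrecPred fun x : α × ℕ => ((Encodable.decode (α := β) x.2.unpair.1).map
      fun b => decide (r ((x.1, b), x.2.unpair.2))).getD false = true :=
    ⟨inferInstance, h.of_eq fun x => by simp⟩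
  refine (rePred_of_primrecPred h').of_eq fun a => ?_
  simp only [hpr]
  constructor
  · rintro ⟨k, hk⟩
    rcases hb : Encodable.decode (α := β) k.unpair.1 with _ | b
    · simp [hb] at hk
    · exact ⟨b, k.unpair.2, by simpa [hb] using hk⟩
  · rintro ⟨b, k, hk⟩
    exact ⟨Nat.pair (Encodable.encode b) k, by simpa using hk⟩

theorem rePred_graph {f : α →. β} (hf : Partrec f) : REPred fun x : α × β => x.2 ∈ f x.1 := by
  classical
  have : DecidableEq β := Encodable.decidableEqOfEncodable β
  have h : Partrec fun x : α × β => (f x.1).bind fun b =>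
      bif decide (b = x.2) then Part.some () else Part.none := by
    refine Partrec.bind (hf.comp Computable.fst) (Partrec.cond ?_ (Computable.const ()).partrec
      Partrec.none)
    exact (Primrec.eq.decide.comp Primrec.snd (Primrec.snd.comp Primrec.fst)).to_comp
  refine h.dom_re.of_eq fun x => ?_
  rw [Part.dom_iff_mem]
  constructor
  · rintro ⟨y, hy⟩
    obtain ⟨b, hb, hy⟩ := Part.mem_bind_iff.1 hy
    by_cases hbx : b = x.2
    · exact hbx ▸ hb
    · simp [hbx] at hy
  · intro hx
    exact ⟨(), Part.mem_bind_iff.2 ⟨x.2, hx, by simp⟩⟩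

theorem rePred_exists_of_primrecPred {p : α × β → Prop} (hp : PrimrecPred p) :
    REPred fun a => ∃ b, p (a, b) := by
  refine rePred_exists ((rePred_of_primrecPred (hp.comp Primrec.fst)).of_eq fun x => ?_)
  simp

end RE

/-! ### Primitive recursive arithmetic on naturals and integers -/

theorem primrec_nat_pow : Primrec₂ ((· ^ ·) : ℕ → ℕ → ℕ) :=
  Primrec₂.unpaired'.1 Nat.Primrec.pow

theorem primrec_natAbs : Primrec Int.natAbs := by
  refine (Primrec.nat_div2.comp (Primrec.succ.comp Primrec.encode) :
    Primrec fun z : ℤ => (Encodable.encode z).succ.div2).of_eq fun z => ?_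
  rcases z with x | x
  · change (2 * x + 1).div2 = x
    simp [Nat.div2_val]
  · change (2 * x + 1 + 1).div2 = x + 1
    simp [Nat.div2_val]

theorem primrec_toNat : Primrec Int.toNat := by
  refine (Primrec.cond (Primrec.nat_bodd.comp Primrec.encode) (Primrec.const 0)
    (Primrec.nat_div2.comp Primrec.encode) :
    Primrec fun z : ℤ => bif (Encodable.encode z).bodd then 0 else
      (Encodable.encode z).div2).of_eq fun z => ?_
  rcases z with x | x
  · change (bif (2 * x).bodd then 0 else (2 * x).div2) = x
    simp [Nat.div2_val]
  · change (bif (2 * x + 1).bodd then 0 else (2 * x + 1).div2) = 0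
    simp

theorem primrec_natAbs_sub : Primrec₂ fun x y : ℤ => (x - y).natAbs := by
  -- With positive and negative parts, `x - y = (x⁺ + y⁻) - (y⁺ + x⁻)`; the absolute value is the
  -- sum of the two truncated differences.
  have hp : Primrec fun z : ℤ × ℤ => (z.1.toNat + (z.2.natAbs - z.2.toNat)) :=
    Primrec.nat_add.comp (primrec_toNat.comp Primrec.fst) (Primrec.nat_sub.comp
      (primrec_natAbs.comp Primrec.snd) (primrec_toNat.comp Primrec.snd))
  have hq : Primrec fun z : ℤ × ℤ => (z.2.toNat + (z.1.natAbs - z.1.toNat)) :=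
    hp.comp (Primrec.snd.pair Primrec.fst)
  refine (Primrec.nat_add.comp (Primrec.nat_sub.comp hp hq)
    (Primrec.nat_sub.comp hq hp)).of_eq fun z => ?_
  dsimp only
  omega

/-! ### Rational piecewise linear approximation -/

theorem sum_hat (n : ℕ) {s : ℝ} (hs : 0 ≤ s) :
    ∑ k : Fin n, max 0 (1 - |s - (k : ℕ)|) = max 0 (min 1 (n - s)) := by
  rw [Fin.sum_univ_eq_sum_range fun k => max 0 (1 - |s - (k : ℝ)|)]
  induction n with
  | zero =>
    rw [Finset.sum_range_zero, max_eq_left]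
    exact (min_le_right _ _).trans (by simpa using hs)
  | succ n ih =>
    rw [Finset.sum_range_succ, ih]
    push_cast
    rcases le_total (s - n) 0 with h | h
    · rw [abs_of_nonpos h, min_eq_left (by linarith : (1 : ℝ) ≤ n + 1 - s)]
      rcases le_total 1 (n - s) with h1 | h1
      · rw [min_eq_left h1, max_eq_left (by linarith : 1 - -(s - n) ≤ 0)]; simp
      · rw [min_eq_right h1, max_eq_right (by linarith : 0 ≤ n - s),
          max_eq_right (by linarith : 0 ≤ 1 - -(s - n))]
        simp
    · rw [abs_of_nonneg h, min_eq_right (by linarith : n - s ≤ 1),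
        max_eq_left (by linarith : n - s ≤ 0), min_eq_right (by linarith : n + 1 - s ≤ 1), zero_add]
      congr 1; ring

/-- At a node only its own hat is nonzero, so values there are read off the code exactly. The
default `0` covers nodes beyond the list. -/
theorem interpolant_grid (m d : ℕ) (v : List ℤ) (k : ℕ) :
    interpolant m d v (k / ((m : ℝ) + 1)) = (v.getD k 0 : ℝ) / ((d : ℝ) + 1) := by
  have hm : ((m : ℝ) + 1) ≠ 0 := by positivity
  unfold interpolant
  rw [mul_div_cancel₀ _ hm]
  have hz : ∀ i : ℕ, i ≠ k → max 0 (1 - |(k : ℝ) - i|) = 0 := by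
    intro i hi
    refine max_eq_left ?_
    have : (1 : ℤ) ≤ |(k : ℤ) - i| := Int.one_le_abs (by omega)
    have h' : (1 : ℝ) ≤ |(k : ℝ) - i| := by exact_mod_cast this
    linarith
  by_cases hk : k < v.length
  · rw [Finset.sum_eq_single ⟨k, hk⟩]
    · simp [hk]
    · intro i _ hi
      rw [hz i (fun h => hi (Fin.ext h)), mul_zero]
    · simp
  · rw [Finset.sum_eq_zero]
    · rw [List.getD_eq_default _ _ (not_lt.1 hk)]; simp
    · intro i _
      rw [hz i (by omega), mul_zero]

/-- The length condition makes the hats a partition of unity at `t`, so the interpolant is a convex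
combination of the neighbouring node values. -/
theorem abs_interpolant_sub_le {m d : ℕ} {v : List ℤ} {t y η : ℝ} (ht : 0 ≤ t)
    (hlen : ((m : ℝ) + 1) * t + 1 ≤ v.length)
    (h : ∀ k : Fin v.length, |t - k / ((m : ℝ) + 1)| < 1 / ((m : ℝ) + 1) →
      |(v.get k : ℝ) / ((d : ℝ) + 1) - y| ≤ η) :
    |interpolant m d v t - y| ≤ η := by
  have hm : (0 : ℝ) < (m : ℝ) + 1 := by positivity
  have hsum : ∑ k : Fin v.length, max 0 (1 - |((m : ℝ) + 1) * t - (k : ℕ)|) = 1 := by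
    rw [sum_hat _ (by positivity), min_eq_left (by linarith), max_eq_right zero_le_one]
  have hrw : interpolant m d v t - y = ∑ k : Fin v.length,
      ((v.get k : ℝ) / ((d : ℝ) + 1) - y) * max 0 (1 - |((m : ℝ) + 1) * t - (k : ℕ)|) := by
    simp only [sub_mul, Finset.sum_sub_distrib, ← Finset.mul_sum, hsum, mul_one]
    rfl
  rw [hrw]
  refine (Finset.abs_sum_le_sum_abs _ _).trans ?_
  calc _ ≤ ∑ k : Fin v.length, η * max 0 (1 - |((m : ℝ) + 1) * t - (k : ℕ)|) := by
        refine Finset.sum_le_sum fun k _ => ?_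
        rw [abs_mul, abs_of_nonneg (le_max_left (0 : ℝ) _)]
        rcases le_or_gt (1 - |((m : ℝ) + 1) * t - (k : ℕ)|) 0 with h0 | h0
        · rw [max_eq_left h0]; simp
        · refine mul_le_mul_of_nonneg_right (h k ?_) (le_max_left _ _)
          have : t - k / ((m : ℝ) + 1) = (((m : ℝ) + 1) * t - (k : ℕ)) / ((m : ℝ) + 1) := by
            field_simp
          rw [this, abs_div, abs_of_pos hm]
          gcongr
          linarith
    _ = η := by rw [← Finset.mul_sum, hsum, mul_one]

theorem exists_mem_basicOpen {I : Set ℝ≥0} (f : C(I, ℝ)) {F : ℝ → ℝ} (hF : Continuous F)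
    (hfF : ∀ t : I, F (t : ℝ≥0) = f t) (N : ℕ) {G : ℕ} (hG : 0 < G) {η : ℝ} (hη : 0 < η) :
    ∃ (M m d j : ℕ) (v : List ℤ), m + 1 = M * G ∧ ((j : ℝ) + 1) / ((d : ℝ) + 1) < η ∧
      f ∈ basicOpen I (N, m, d, j, v) := by
  have huc := (isCompact_Icc (a := (-1 : ℝ)) (b := N + 3)).uniformContinuousOn_of_continuous
    hF.continuousOn
  rw [Metric.uniformContinuousOn_iff] at huc
  obtain ⟨δ, hδ, huc⟩ := huc (η / 8) (by positivity)
  obtain ⟨M, hM⟩ := exists_nat_one_div_lt (lt_min hδ one_pos)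
  obtain ⟨d, hd⟩ := exists_nat_one_div_lt (show 0 < η / 8 by positivity)
  set m := (M + 1) * G - 1 with hmdef
  have hm : m + 1 = (M + 1) * G := Nat.sub_add_cancel (Nat.mul_pos M.succ_pos hG)
  have hmM : 1 / ((m : ℝ) + 1) ≤ 1 / ((M : ℝ) + 1) := by
    have : M + 1 ≤ m + 1 := hm ▸ Nat.le_mul_of_pos_right _ hG
    have : (M : ℝ) + 1 ≤ m + 1 := by exact_mod_cast this
    gcongr
  have hm0 : (0 : ℝ) < (m : ℝ) + 1 := by positivity
  have hd0 : (0 : ℝ) < (d : ℝ) + 1 := by positivity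
  -- The radius lies between `η / 2` and `η`. The approximation error is at most `η / 4`: one `η /
  -- 8` from uniform continuity, one from rounding the node values.
  refine ⟨M + 1, m, d, ⌊η / 2 * ((d : ℝ) + 1)⌋₊,
    (List.range ((N + 1) * (m + 1) + 1)).map fun k : ℕ => ⌊F (k / ((m : ℝ) + 1)) * ((d : ℝ) + 1)⌋,
    hm, ?_, ?_⟩
  · rw [div_lt_iff₀ hd0]
    have h1 := Nat.floor_le (show 0 ≤ η / 2 * ((d : ℝ) + 1) by positivity)
    rw [div_lt_iff₀ hd0] at hd
    nlinarith
  · intro t ht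
    have ht0 : (0 : ℝ) ≤ (t : ℝ≥0) := NNReal.coe_nonneg _
    have ht1 : ((t : ℝ≥0) : ℝ) ≤ N + 1 := by exact_mod_cast ht
    rw [abs_sub_comm]
    refine lt_of_le_of_lt (b := η / 4) (abs_interpolant_sub_le ht0 ?_ ?_) ?_
    · simp only [List.length_map, List.length_range]
      push_cast
      nlinarith
    · intro k hk
      have hk' := hk.trans_le (hmM.trans hM.le)
      rw [lt_min_iff, abs_lt] at hk'
      have hk1 : dist (F (t : ℝ≥0)) (F (k / ((m : ℝ) + 1))) < η / 8 := by
        refine huc _ ⟨by linarith, by linarith⟩ _ ⟨?_, ?_⟩ ?_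
        · have : (0 : ℝ) ≤ k / ((m : ℝ) + 1) := by positivity
          linarith
        · have := (abs_lt.1 hk'.2).1
          linarith
        · rw [Real.dist_eq, abs_lt]; exact hk'.1
      rw [Real.dist_eq, hfF, abs_lt] at hk1
      simp only [List.get_eq_getElem, List.getElem_map, List.getElem_range]
      set y := F (k / ((m : ℝ) + 1))
      have h1 := Int.floor_le (y * ((d : ℝ) + 1))
      have h2 := Int.lt_floor_add_one (y * ((d : ℝ) + 1))
      have h3 : (⌊y * ((d : ℝ) + 1)⌋ : ℝ) / ((d : ℝ) + 1) ≤ y := by rwa [div_le_iff₀ hd0]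
      have h4 : y < (⌊y * ((d : ℝ) + 1)⌋ : ℝ) / ((d : ℝ) + 1) + 1 / ((d : ℝ) + 1) := by
        rw [← add_div, lt_div_iff₀ hd0]; exact h2
      rw [abs_le]
      constructor <;> linarith [hk1.1, hk1.2]
    · rw [lt_div_iff₀ hd0]
      have := Nat.lt_floor_add_one (η / 2 * ((d : ℝ) + 1))
      nlinarith

theorem exists_continuous_extension {I : Set ℝ≥0} (hI : I = Set.Icc 0 1 ∨ I = Set.univ)
    (f : C(I, ℝ)) : ∃ F : ℝ → ℝ, Continuous F ∧ ∀ t : I, F (t : ℝ≥0) = f t := by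
  rcases hI with rfl | rfl
  · refine ⟨fun x => f ⟨min x.toNNReal 1, zero_le, min_le_right _ _⟩, ?_, fun t => ?_⟩
    · refine f.continuous.comp ?_
      exact Continuous.subtype_mk (by fun_prop) _
    · exact congrArg f (Subtype.ext (by simpa using t.2.2))
  · refine ⟨fun x => f ⟨x.toNNReal, trivial⟩, ?_, fun t => ?_⟩
    · refine f.continuous.comp ?_
      exact Continuous.subtype_mk (by fun_prop) _
    · exact congrArg f (Subtype.ext (by simp))

/-! ### An effective Borel–Cantelli lemma -/

/-- The tails `⋃ n ≥ b * m + e, A n` form a Martin-Löf test once `ρ ^ b ≤ 1/2` and `C (1 - ρ)⁻¹ ρ ^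
e ≤ 1`. -/
theorem IsMLRandom.exists_forall_notMem {I : Set ℝ≥0} {μ : Measure C(I, ℝ)} {B : C(I, ℝ)}
    (hB : IsMLRandom μ B) {A : ℕ → Set C(I, ℝ)} (hA : UniformlyEffectivelyOpen A)
    {C ρ : ℝ≥0∞} (hC : C ≠ ⊤) (hρ : ρ < 1) (hμA : ∀ n, μ (A n) ≤ C * ρ ^ n) :
    ∃ M, ∀ n ≥ M, B ∉ A n := by
  obtain ⟨W, hW, hWA⟩ := hA
  have hpow := ENNReal.tendsto_pow_atTop_nhds_zero_of_lt_one hρ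
  obtain ⟨b, hb⟩ := (hpow.eventually_le_const (u := 2⁻¹) (by simp)).exists
  have hD : C * (1 - ρ)⁻¹ ≠ ⊤ :=
    ENNReal.mul_ne_top hC (ENNReal.inv_ne_top.2 (tsub_pos_of_lt hρ).ne')
  have hpow' := ENNReal.Tendsto.const_mul hpow (Or.inr hD)
  rw [mul_zero] at hpow'
  obtain ⟨e, he⟩ := (hpow'.eventually_le_const (u := 1) one_pos).exists
  have htest : IsMLTest μ fun m => {f | ∃ n, b * m + e ≤ n ∧ f ∈ A n} := by
    refine ⟨⟨fun x => ∃ n, W (n, x.2) ∧ b * x.1 + e ≤ n, ?_, fun m => ?_⟩, fun m => ?_⟩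
    · refine rePred_exists (p := fun y : (ℕ × BallCode) × ℕ =>
        W (y.2, y.1.2) ∧ b * y.1.1 + e ≤ y.2) (rePred_and (rePred_comp hW ?_) ?_)
      · exact (Primrec.snd.pair (Primrec.snd.comp Primrec.fst)).to_comp
      · exact Primrec.nat_le.comp (Primrec.nat_add.comp (Primrec.nat_mul.comp (Primrec.const b)
          (Primrec.fst.comp Primrec.fst)) (Primrec.const e)) Primrec.snd
    · ext f
      simp only [hWA, Set.mem_ofPred_eq]
      constructor
      · rintro ⟨n, hn, c, hc, hf⟩
        exact ⟨c, ⟨n, hc, hn⟩, hf⟩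
      · rintro ⟨c, ⟨n, hc, hn⟩, hf⟩
        exact ⟨n, hn, c, hc, hf⟩
    · have hsub : {f | ∃ n, b * m + e ≤ n ∧ f ∈ A n} ⊆ ⋃ n, A (b * m + e + n) := by
        rintro f ⟨n, hn, hf⟩
        exact Set.mem_iUnion.2 ⟨n - (b * m + e), by rwa [Nat.add_sub_cancel' hn]⟩
      calc μ {f | ∃ n, b * m + e ≤ n ∧ f ∈ A n}
          ≤ ∑' n, μ (A (b * m + e + n)) := (measure_mono hsub).trans (measure_iUnion_le _)
        _ ≤ ∑' n, C * ρ ^ (b * m + e) * ρ ^ n :=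
            ENNReal.tsum_le_tsum fun n => by rw [mul_assoc, ← pow_add]; exact hμA _
        _ = C * (1 - ρ)⁻¹ * ρ ^ e * (ρ ^ b) ^ m := by
            rw [ENNReal.tsum_mul_left, ENNReal.tsum_geometric, pow_add, pow_mul]; ring
        _ ≤ 1 * 2⁻¹ ^ m := by gcongr
        _ = 2⁻¹ ^ m := one_mul _
  have hB' := hB _ htest
  simp only [Set.mem_iInter, Set.mem_ofPred_eq, not_forall, not_exists, not_and] at hB'
  obtain ⟨m, hm⟩ := hB'
  exact ⟨b * m + e, hm⟩

/-! ### Effectively open events determined by values on grids -/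

/-- The value of a path at `x`, which is `0` outside of its domain. -/
def pathVal {I : Set ℝ≥0} (f : C(I, ℝ)) (x : ℝ≥0) : ℝ :=
  open Classical in if h : x ∈ I then f ⟨x, h⟩ else 0

theorem pathVal_of_mem {I : Set ℝ≥0} (f : C(I, ℝ)) {x : ℝ≥0} (h : x ∈ I) :
    pathVal f x = f ⟨x, h⟩ :=
  dif_pos h

theorem div_le_of_le_mul_nat {N G j : ℕ} (hG : 0 < G) (hj : j ≤ (N + 1) * G) :
    (j : ℝ≥0) / G ≤ (N : ℝ≥0) + 1 := by
  rw [div_le_iff₀ (by exact_mod_cast hG)]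
  exact_mod_cast hj

/-- Since `m + 1 = M * G`, the grid point `j / G` is the node with index `j * M`. -/
theorem abs_pathVal_sub_lt {I : Set ℝ≥0} {f : C(I, ℝ)} {N m d r M G j : ℕ} {v : List ℤ}
    (hNI : ∀ x : ℝ≥0, x ≤ N + 1 → x ∈ I) (hf : f ∈ basicOpen I (N, m, d, r, v))
    (hm : m + 1 = M * G) (hj : j ≤ (N + 1) * G) :
    |pathVal f (j / G) - (v.getD (j * M) 0 : ℝ) / ((d : ℝ) + 1)| <
      ((r : ℝ) + 1) / ((d : ℝ) + 1) := by
  have hG : 0 < G := Nat.pos_of_ne_zero fun h => by simp [h] at hm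
  have hM : 0 < M := Nat.pos_of_ne_zero fun h => by simp [h] at hm
  have hx := div_le_of_le_mul_nat hG hj
  have hGr : (G : ℝ) ≠ 0 := by positivity
  have hMr : (M : ℝ) ≠ 0 := by positivity
  have hpt : (((j : ℝ≥0) / G : ℝ≥0) : ℝ) = ((j * M : ℕ) : ℝ) / ((m : ℝ) + 1) := by
    have : (m : ℝ) + 1 = M * G := by exact_mod_cast hm
    rw [this]
    push_cast
    field_simp
  have := hf ⟨_, hNI _ hx⟩ hx
  rw [pathVal_of_mem f (hNI _ hx), ← interpolant_grid, ← hpt]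
  exact this

/-- Some increment of the path over a part of a grid interval of length `4⁻ⁿ` is large. -/
def incrementEvent (I : Set ℝ≥0) (N n : ℕ) : Set C(I, ℝ) :=
  {f | ∃ j ≤ (N + 1) * 4 ^ (n + 1), ((n : ℝ) + 1) / 2 ^ n <
    |pathVal f (j / (4 ^ (n + 1) : ℕ)) - pathVal f ((j / 4 * 4 : ℕ) / (4 ^ (n + 1) : ℕ))|}

theorem incrementEvent_effectivelyOpen {I : Set ℝ≥0} (hI : I = Set.Icc 0 1 ∨ I = Set.univ)
    {N : ℕ} (hNI : ∀ x : ℝ≥0, x ≤ N + 1 → x ∈ I) :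
    UniformlyEffectivelyOpen (incrementEvent I N) := by
  -- The witness is `(j, M)`. The last conjunct, cleared of denominators, says that the two node
  -- values differ by at least the threshold plus twice the radius. Equality is allowed because the
  -- balls are open.
  let Q : (ℕ × BallCode) × (ℕ × ℕ) → Prop := fun x =>
    x.1.2.1 = N ∧ x.1.2.2.1 + 1 = x.2.2 * 4 ^ (x.1.1 + 1) ∧
      x.2.1 ≤ (N + 1) * 4 ^ (x.1.1 + 1) ∧
      (x.1.1 + 1) * (x.1.2.2.2.1 + 1) + 2 * (x.1.2.2.2.2.1 + 1) * 2 ^ x.1.1 ≤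
        2 ^ x.1.1 * (x.1.2.2.2.2.2.getD (x.2.1 * x.2.2) 0 -
          x.1.2.2.2.2.2.getD (x.2.1 / 4 * 4 * x.2.2) 0).natAbs
  refine ⟨fun y => ∃ z, Q (y, z), rePred_exists_of_primrecPred ?_, fun n => ?_⟩
  · have hn : Primrec fun x : (ℕ × BallCode) × (ℕ × ℕ) => x.1.1 := Primrec.fst.comp Primrec.fst
    have hc : Primrec fun x : (ℕ × BallCode) × (ℕ × ℕ) => x.1.2 := Primrec.snd.comp Primrec.fst
    have hm := Primrec.fst.comp (Primrec.snd.comp hc)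
    have hd := Primrec.fst.comp (Primrec.snd.comp (Primrec.snd.comp hc))
    have hr := Primrec.fst.comp (Primrec.snd.comp (Primrec.snd.comp (Primrec.snd.comp hc)))
    have hv := Primrec.snd.comp (Primrec.snd.comp (Primrec.snd.comp (Primrec.snd.comp hc)))
    have hj : Primrec fun x : (ℕ × BallCode) × (ℕ × ℕ) => x.2.1 := Primrec.fst.comp Primrec.snd
    have hM : Primrec fun x : (ℕ × BallCode) × (ℕ × ℕ) => x.2.2 := Primrec.snd.comp Primrec.snd
    have h4 := primrec_nat_pow.comp (Primrec.const 4) (Primrec.succ.comp hn)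
    have h2 := primrec_nat_pow.comp (Primrec.const 2) hn
    refine (Primrec.eq.comp (Primrec.fst.comp hc) (Primrec.const N)).and
      ((Primrec.eq.comp (Primrec.succ.comp hm) (Primrec.nat_mul.comp hM h4)).and
      ((Primrec.nat_le.comp hj (Primrec.nat_mul.comp (Primrec.const (N + 1)) h4)).and
      (Primrec.nat_le.comp (Primrec.nat_add.comp
        (Primrec.nat_mul.comp (Primrec.succ.comp hn) (Primrec.succ.comp hd))
        (Primrec.nat_mul.comp (Primrec.nat_mul.comp (Primrec.const 2) (Primrec.succ.comp hr)) h2))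
        (Primrec.nat_mul.comp h2 (primrec_natAbs_sub.comp
          ((Primrec.list_getD 0).comp hv (Primrec.nat_mul.comp hj hM))
          ((Primrec.list_getD 0).comp hv (Primrec.nat_mul.comp (Primrec.nat_mul.comp
            (Primrec.nat_div.comp hj (Primrec.const 4)) (Primrec.const 4)) hM)))))))
  · ext f
    constructor
    · rintro ⟨j, hj, hlt⟩
      obtain ⟨F, hF, hfF⟩ := exists_continuous_extension hI f
      -- A quarter of the gap: two radii are lost in passing to node values, and two more are
      -- required by `Q`.
      obtain ⟨M, m, d, r, v, hm, hr, hf⟩ := exists_mem_basicOpen f hF hfF N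
        (G := 4 ^ (n + 1)) (by positivity) (η := (|pathVal f (j / (4 ^ (n + 1) : ℕ)) -
          pathVal f ((j / 4 * 4 : ℕ) / (4 ^ (n + 1) : ℕ))| - ((n : ℝ) + 1) / 2 ^ n) / 4)
        (by linarith)
      refine ⟨(N, m, d, r, v), ⟨(j, M), rfl, hm, hj, ?_⟩, hf⟩
      have hx := abs_pathVal_sub_lt hNI hf hm hj
      have hy := abs_pathVal_sub_lt hNI hf hm ((Nat.div_mul_le_self j 4).trans hj)
      have hd0 : (0 : ℝ) < (d : ℝ) + 1 := by positivity
      dsimp only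
      rw [← @Nat.cast_le ℝ]
      push_cast [Nat.cast_natAbs]
      set X := pathVal f (j / (4 ^ (n + 1) : ℕ))
      set Y := pathVal f ((j / 4 * 4 : ℕ) / (4 ^ (n + 1) : ℕ))
      set x : ℝ := (v.getD (j * M) 0 : ℝ)
      set y : ℝ := (v.getD (j / 4 * 4 * M) 0 : ℝ)
      have h1 : |X - Y| ≤ |x - y| / (d + 1) + 2 * ((r + 1) / ((d : ℝ) + 1)) := by
        have e1 : X - Y = (X - x / (d + 1)) - (Y - y / (d + 1)) + (x - y) / (d + 1) := by ring
        rw [e1]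
        refine (abs_add_le _ _).trans ?_
        rw [abs_div, abs_of_pos hd0]
        have := abs_sub (X - x / (d + 1)) (Y - y / (d + 1))
        linarith
      have h2 : ((n : ℝ) + 1) / 2 ^ n + 2 * ((r + 1) / ((d : ℝ) + 1)) ≤ |x - y| / (d + 1) := by
        linarith
      have h3 : ((n : ℝ) + 1) / 2 ^ n + 2 * ((r + 1) / ((d : ℝ) + 1)) =
        ((n + 1) * (d + 1) + 2 * (r + 1) * 2 ^ n) / (2 ^ n * (d + 1)) := by field_simp
      rw [h3, div_le_div_iff₀ (by positivity) hd0] at h2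
      refine le_of_mul_le_mul_right ?_ hd0
      linarith
    · rintro ⟨⟨N', m, d, r, v⟩, ⟨⟨j, M⟩, hN, hm, hj, hle⟩, hf⟩
      dsimp only at hN hm hj hle
      subst hN
      refine ⟨j, hj, ?_⟩
      have hx := abs_pathVal_sub_lt hNI hf hm hj
      have hy := abs_pathVal_sub_lt hNI hf hm ((Nat.div_mul_le_self j 4).trans hj)
      have hd0 : (0 : ℝ) < (d : ℝ) + 1 := by positivity
      rw [← @Nat.cast_le ℝ] at hle
      push_cast [Nat.cast_natAbs] at hle
      set X := pathVal f (j / (4 ^ (n + 1) : ℕ))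
      set Y := pathVal f ((j / 4 * 4 : ℕ) / (4 ^ (n + 1) : ℕ))
      set x : ℝ := (v.getD (j * M) 0 : ℝ)
      set y : ℝ := (v.getD (j / 4 * 4 * M) 0 : ℝ)
      have h1 : |x - y| / (d + 1) < |X - Y| + 2 * ((r + 1) / ((d : ℝ) + 1)) := by
        have e1 : (x - y) / (d + 1) = X - Y - ((X - x / (d + 1)) - (Y - y / (d + 1))) := by ring
        rw [← abs_of_pos hd0, ← abs_div, abs_of_pos hd0, e1]
        refine (abs_sub _ _).trans_lt ?_
        have := abs_sub (X - x / (d + 1)) (Y - y / (d + 1))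
        linarith
      have h2 : ((n : ℝ) + 1) / 2 ^ n + 2 * ((r + 1) / ((d : ℝ) + 1)) ≤ |x - y| / (d + 1) := by
        have h3 : ((n : ℝ) + 1) / 2 ^ n + 2 * ((r + 1) / ((d : ℝ) + 1)) =
          ((n + 1) * (d + 1) + 2 * (r + 1) * 2 ^ n) / (2 ^ n * (d + 1)) := by field_simp
        rw [h3, div_le_div_iff₀ (by positivity) hd0]
        nlinarith [mul_le_mul_of_nonneg_right hle hd0.le]
      linarith

/-- The numerator of the dyadic rational with integer part `k` and binary digits `σ`. -/
def dyadicNumerator (k : ℕ) (σ : List Bool) : ℕ :=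
  σ.foldl (fun a b => 2 * a + b.toNat) k

theorem primrec_dyadicNumerator (k : ℕ) : Primrec (dyadicNumerator k) := by
  refine Primrec.list_foldl (f := fun σ : List Bool => σ) (g := fun _ => k)
    (h := fun _ x => 2 * x.1 + Bool.toNat x.2) Primrec.id (Primrec.const k) ?_
  exact Primrec.nat_add.comp (Primrec.nat_mul.comp (Primrec.const 2)
    (Primrec.fst.comp Primrec.snd)) ((Primrec.dom_bool _).comp (Primrec.snd.comp Primrec.snd))

/-- The path is small at some grid point which is bounded away from `0` and has a short program. -/
def smallValueEvent (I : Set ℝ≥0) (U : List Bool →. List Bool) (N R q k n : ℕ) : Set C(I, ℝ) :=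
  {f | ∃ p σ : List Bool, σ ∈ U p ∧ 2 * q * p.length + 2 * n ≤ q * n ∧ σ.length = n ∧
    dyadicNumerator k σ / 2 ^ (n % 2) ≤ (N + 1) * 4 ^ (n / 2) ∧
    4 ^ (n / 2) ≤ dyadicNumerator k σ / 2 ^ (n % 2) * R ∧
    |pathVal f ((dyadicNumerator k σ / 2 ^ (n % 2) : ℕ) / (4 ^ (n / 2) : ℕ))| <
      (2 * (n / 2 : ℕ) + 5) / 2 ^ (n / 2)}

theorem smallValueEvent_effectivelyOpen {I : Set ℝ≥0} (hI : I = Set.Icc 0 1 ∨ I = Set.univ)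
    {U : List Bool →. List Bool} (hU : Partrec U)
    {N : ℕ} (hNI : ∀ x : ℝ≥0, x ≤ N + 1 → x ∈ I) (R q k : ℕ) :
    UniformlyEffectivelyOpen (smallValueEvent I U N R q k) := by
  -- Everything except `σ ∈ U p` is decidable. The last conjunct says that the node value plus the
  -- radius is at most the threshold.
  let Q : (ℕ × BallCode) × ((List Bool × List Bool) × ℕ) → Prop := fun x =>
    2 * q * x.2.1.1.length + 2 * x.1.1 ≤ q * x.1.1 ∧ x.2.1.2.length = x.1.1 ∧
    dyadicNumerator k x.2.1.2 / 2 ^ (x.1.1 % 2) ≤ (N + 1) * 4 ^ (x.1.1 / 2) ∧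
    4 ^ (x.1.1 / 2) ≤ dyadicNumerator k x.2.1.2 / 2 ^ (x.1.1 % 2) * R ∧
    x.1.2.1 = N ∧ x.1.2.2.1 + 1 = x.2.2 * 4 ^ (x.1.1 / 2) ∧
      2 ^ (x.1.1 / 2) * ((x.1.2.2.2.2.2.getD
        (dyadicNumerator k x.2.1.2 / 2 ^ (x.1.1 % 2) * x.2.2) 0).natAbs
        + (x.1.2.2.2.2.1 + 1)) ≤ (2 * (x.1.1 / 2) + 5) * (x.1.2.2.2.1 + 1)
  refine ⟨fun y => ∃ z : (List Bool × List Bool) × ℕ, z.1.2 ∈ U z.1.1 ∧ Q (y, z),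
    rePred_exists (p := fun x : (ℕ × BallCode) × ((List Bool × List Bool) × ℕ) =>
      x.2.1.2 ∈ U x.2.1.1 ∧ Q x) (rePred_and
      (rePred_comp (rePred_graph hU) (Primrec.fst.comp Primrec.snd).to_comp) ?_), fun n => ?_⟩
  · have hn : Primrec fun x : (ℕ × BallCode) × ((List Bool × List Bool) × ℕ) => x.1.1 :=
      Primrec.fst.comp Primrec.fst
    have hc : Primrec fun x : (ℕ × BallCode) × ((List Bool × List Bool) × ℕ) => x.1.2 :=
      Primrec.snd.comp Primrec.fst
    have hm := Primrec.fst.comp (Primrec.snd.comp hc)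
    have hd := Primrec.fst.comp (Primrec.snd.comp (Primrec.snd.comp hc))
    have hr := Primrec.fst.comp (Primrec.snd.comp (Primrec.snd.comp (Primrec.snd.comp hc)))
    have hv := Primrec.snd.comp (Primrec.snd.comp (Primrec.snd.comp (Primrec.snd.comp hc)))
    have hM : Primrec fun x : (ℕ × BallCode) × ((List Bool × List Bool) × ℕ) => x.2.2 :=
      Primrec.snd.comp Primrec.snd
    have hp : Primrec fun x : (ℕ × BallCode) × ((List Bool × List Bool) × ℕ) => x.2.1.1 :=
      Primrec.fst.comp (Primrec.fst.comp Primrec.snd)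
    have hσ : Primrec fun x : (ℕ × BallCode) × ((List Bool × List Bool) × ℕ) => x.2.1.2 :=
      Primrec.snd.comp (Primrec.fst.comp Primrec.snd)
    have hi := Primrec.nat_div.comp hn (Primrec.const 2)
    have h4 := primrec_nat_pow.comp (Primrec.const 4) hi
    have h2 := primrec_nat_pow.comp (Primrec.const 2) hi
    have hj := Primrec.nat_div.comp ((primrec_dyadicNumerator k).comp hσ)
      (primrec_nat_pow.comp (Primrec.const 2) (Primrec.nat_mod.comp hn (Primrec.const 2)))
    refine (Primrec.nat_le.comp (Primrec.nat_add.comp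
        (Primrec.nat_mul.comp (Primrec.const (2 * q)) (Primrec.list_length.comp hp))
        (Primrec.nat_mul.comp (Primrec.const 2) hn))
        (Primrec.nat_mul.comp (Primrec.const q) hn)).and
      ((Primrec.eq.comp (Primrec.list_length.comp hσ) hn).and
      ((Primrec.nat_le.comp hj (Primrec.nat_mul.comp (Primrec.const (N + 1)) h4)).and
      ((Primrec.nat_le.comp h4 (Primrec.nat_mul.comp hj (Primrec.const R))).and
      ((Primrec.eq.comp (Primrec.fst.comp hc) (Primrec.const N)).and
      ((Primrec.eq.comp (Primrec.succ.comp hm) (Primrec.nat_mul.comp hM h4)).and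
      (Primrec.nat_le.comp (Primrec.nat_mul.comp h2 (Primrec.nat_add.comp
        (primrec_natAbs.comp ((Primrec.list_getD 0).comp hv (Primrec.nat_mul.comp hj hM)))
        (Primrec.succ.comp hr)))
        (Primrec.nat_mul.comp (Primrec.nat_add.comp
          (Primrec.nat_mul.comp (Primrec.const 2) hi) (Primrec.const 5))
          (Primrec.succ.comp hd))))))))
  · ext f
    constructor
    · rintro ⟨p, σ, hpσ, hpn, hσ, hjN, hjR, hlt⟩
      obtain ⟨F, hF, hfF⟩ := exists_continuous_extension hI f
      set j := dyadicNumerator k σ / 2 ^ (n % 2) with hjdef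
      obtain ⟨M, m, d, r, v, hm, hr, hf⟩ := exists_mem_basicOpen f hF hfF N
        (G := 4 ^ (n / 2)) (by positivity) (η := ((2 * (n / 2 : ℕ) + 5) / 2 ^ (n / 2) -
          |pathVal f (j / (4 ^ (n / 2) : ℕ))|) / 2) (by linarith)
      refine ⟨(N, m, d, r, v), ⟨((p, σ), M), hpσ, hpn, hσ, hjN, hjR, rfl, hm, ?_⟩, hf⟩
      have hx := abs_pathVal_sub_lt hNI hf hm hjN
      have hd0 : (0 : ℝ) < (d : ℝ) + 1 := by positivity
      dsimp only
      rw [← hjdef, ← @Nat.cast_le ℝ]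
      push_cast [Nat.cast_natAbs]
      push_cast at hlt hr hx
      set i := n / 2
      set X := pathVal f (j / 4 ^ i)
      set x : ℝ := (v.getD (j * M) 0 : ℝ)
      have h1 : |x| / (d + 1) < |X| + (r + 1) / ((d : ℝ) + 1) := by
        rw [abs_sub_comm] at hx
        have := abs_sub_abs_le_abs_sub (x / (d + 1)) X
        rw [abs_div, abs_of_pos hd0] at this
        linarith
      have h2 : |x| / (d + 1) + (r + 1) / ((d : ℝ) + 1) ≤ (2 * (i : ℝ) + 5) / 2 ^ i := by linarith
      rw [← add_div, div_le_div_iff₀ hd0 (by positivity)] at h2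
      linarith
    · rintro ⟨⟨N', m, d, r, v⟩, ⟨⟨⟨p, σ⟩, M⟩, hpσ, hpn, hσ, hjN, hjR, hN, hm, hle⟩, hf⟩
      dsimp only at hN hm hle hpn hσ hjN hjR hpσ
      subst hN
      refine ⟨p, σ, hpσ, hpn, hσ, hjN, hjR, ?_⟩
      have hx := abs_pathVal_sub_lt hNI hf hm hjN
      have hd0 : (0 : ℝ) < (d : ℝ) + 1 := by positivity
      set j := dyadicNumerator k σ / 2 ^ (n % 2) with hjdef
      rw [← @Nat.cast_le ℝ] at hle
      push_cast [Nat.cast_natAbs] at hle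
      push_cast at hx ⊢
      set i := n / 2
      set X := pathVal f (j / 4 ^ i)
      set x : ℝ := (v.getD (j * M) 0 : ℝ)
      have h1 : |X| < |x| / (d + 1) + (r + 1) / ((d : ℝ) + 1) := by
        have := abs_sub_abs_le_abs_sub X (x / (d + 1))
        rw [abs_div, abs_of_pos hd0] at this
        linarith
      refine h1.trans_le ?_
      rw [← add_div, div_le_div_iff₀ hd0 (by positivity)]
      linarith

/-! ### Gaussian estimates -/

/-- The sub-Gaussian Chernoff bound also covers `v = 0`, which occurs when the two times of an
increment coincide. -/
theorem gaussianReal_setOf_lt_abs_le {v c : ℝ≥0} (hvc : v ≤ c) {ε : ℝ} (hε : 0 ≤ ε) :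
    gaussianReal 0 v {x | ε < |x|} ≤ ENNReal.ofReal (2 * Real.exp (-ε ^ 2 / (2 * c))) := by
  have hsub : HasSubgaussianMGF id c (gaussianReal 0 v) := by
    refine ⟨fun t => integrable_exp_mul_gaussianReal t, fun t => ?_⟩
    rw [mgf_id_gaussianReal]
    simp only [zero_mul, zero_add]
    gcongr
  have h1 := hsub.measure_ge_le hε
  have h2 := hsub.neg.measure_ge_le hε
  rw [← ofReal_measureReal]
  refine ENNReal.ofReal_le_ofReal ?_
  have hss : {x : ℝ | ε < |x|} ⊆ {x | ε ≤ id x} ∪ {x | ε ≤ (-id) x} := fun x hx =>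
    (lt_abs.1 hx).imp (fun h => h.le) (fun h => show ε ≤ -x from h.le)
  calc _ ≤ _ := measureReal_mono hss
    _ ≤ _ := measureReal_union_le _ _
    _ ≤ _ := by rw [two_mul]; exact add_le_add h1 h2

/-- The density is at most `(2πv)^(-1/2) ≤ R`, and the interval has length `2 * D`. -/
theorem gaussianReal_setOf_abs_lt_le {v : ℝ≥0} {R : ℕ} (hv : 1 ≤ v * R) (D : ℝ) :
    gaussianReal 0 v {x | |x| < D} ≤ R * ENNReal.ofReal (2 * D) := by
  have hv0 : v ≠ 0 := by rintro rfl; simp at hv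
  have hvR : (1 : ℝ) ≤ v * R := by exact_mod_cast hv
  have hR0 : R ≠ 0 := by rintro rfl; simp at hv
  have hR : (1 : ℝ) ≤ R := by exact_mod_cast Nat.one_le_iff_ne_zero.2 hR0
  have hpdf : ∀ x, gaussianPDF 0 v x ≤ R := by
    intro x
    rw [gaussianPDF_def, ← ENNReal.ofReal_natCast]
    refine ENNReal.ofReal_le_ofReal ?_
    have hexp : Real.exp (-(x - 0) ^ 2 / (2 * v)) ≤ 1 := by
      rw [Real.exp_le_one_iff, neg_div]
      have : 0 ≤ (x - 0) ^ 2 / (2 * (v : ℝ)) := by positivity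
      linarith
    have hsqrt : (R : ℝ)⁻¹ ≤ √(2 * Real.pi * v) := by
      refine Real.le_sqrt_of_sq_le ?_
      have h1 : (R : ℝ)⁻¹ ≤ v := by rwa [inv_le_iff_one_le_mul₀ (by positivity)]
      have h2 : (R : ℝ)⁻¹ ≤ 1 := inv_le_one_of_one_le₀ hR
      have h3 : (0 : ℝ) ≤ (R : ℝ)⁻¹ := by positivity
      nlinarith [Real.pi_gt_three]
    calc (√(2 * Real.pi * v))⁻¹ * Real.exp (-(x - 0) ^ 2 / (2 * v)) ≤ (√(2 * Real.pi * v))⁻¹ * 1 :=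
          by gcongr
      _ ≤ R := by
          rw [mul_one]
          exact inv_le_of_inv_le₀ (by positivity) hsqrt
  rw [gaussianReal_apply _ hv0]
  calc ∫⁻ x in {x | |x| < D}, gaussianPDF 0 v x ≤ ∫⁻ _ in {x : ℝ | |x| < D}, R :=
        lintegral_mono hpdf
    _ = R * ENNReal.ofReal (2 * D) := by
        have hball : {x : ℝ | |x| < D} = Metric.ball 0 D := by
          ext x; simp
        rw [lintegral_const, Measure.restrict_apply_univ, hball, Real.volume_ball]

section Wiener

variable {I : Set ℝ≥0} {μ : Measure C(I, ℝ)}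

theorem IsWienerMeasure.measure_increment_le (hμ : IsWienerMeasure μ) {s t c : ℝ≥0} (hs : s ∈ I)
    (ht : t ∈ I) (hst : s ≤ t) (hc : t - s ≤ c) {ε : ℝ} (hε : 0 ≤ ε) :
    μ {f | ε < |pathVal f t - pathVal f s|} ≤
      ENNReal.ofReal (2 * Real.exp (-ε ^ 2 / (2 * c))) := by
  have h := (hμ.law_increment ⟨s, hs⟩ ⟨t, ht⟩ hst).measure_eq (p := fun x => ε < |x|)
    (measurableSet_lt measurable_const measurable_id.abs)
  simp only [pathVal_of_mem _ hs, pathVal_of_mem _ ht]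
  rw [h]
  exact gaussianReal_setOf_lt_abs_le hc hε

theorem IsWienerMeasure.measure_value_le (hμ : IsWienerMeasure μ) (h0 : (0 : ℝ≥0) ∈ I) {t : ℝ≥0}
    (ht : t ∈ I) {R : ℕ} (hR : 1 ≤ t * R) (D : ℝ) :
    μ {f | |pathVal f t| < D} ≤ R * ENNReal.ofReal (2 * D) := by
  have h := (hμ.law_increment ⟨0, h0⟩ ⟨t, ht⟩ (zero_le (a := t))).measure_eq (p := fun x => |x| < D)
    (measurableSet_lt measurable_id.abs measurable_const)
  simp only [tsub_zero] at h
  refine le_trans ?_ (h.le.trans (gaussianReal_setOf_abs_lt_le hR D))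
  refine measure_mono_ae ?_
  filter_upwards [hμ.eval_zero ⟨0, h0⟩ rfl] with f hf hlt
  change |f ⟨t, ht⟩ - f ⟨0, h0⟩| < D
  rw [hf, sub_zero, ← pathVal_of_mem f ht]
  exact hlt

theorem exp_neg_sq_le (n : ℕ) :
    Real.exp (-((n : ℝ) + 1) ^ 2 / 2) ≤ Real.exp (3 / 2) * (1 / 8) ^ n := by
  -- The tangent line at `n = 2`; its slope `-3` gives a rate below `1/8`, enough to beat the `4 ^
  -- n` grid points.
  have h1 : -((n : ℝ) + 1) ^ 2 / 2 ≤ 3 / 2 + n * (-3) := by nlinarith [sq_nonneg ((n : ℝ) - 2)]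
  have h2 : Real.exp (-3) ≤ 1 / 8 := by
    rw [Real.exp_neg, one_div]
    refine inv_anti₀ (by norm_num) ?_
    have := Real.add_one_le_exp (1 : ℝ)
    have h3 : Real.exp 3 = Real.exp 1 ^ 3 := by rw [← Real.exp_nat_mul]; norm_num
    rw [h3]
    calc (8 : ℝ) = 2 ^ 3 := by norm_num
      _ ≤ _ := by gcongr; linarith
  calc _ ≤ Real.exp (3 / 2 + n * (-3)) := Real.exp_le_exp.2 h1
    _ = Real.exp (3 / 2) * Real.exp (-3) ^ n := by rw [Real.exp_add, Real.exp_nat_mul]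
    _ ≤ _ := by gcongr

theorem IsWienerMeasure.measure_incrementEvent_le (hμ : IsWienerMeasure μ) {N : ℕ}
    (hNI : ∀ x : ℝ≥0, x ≤ N + 1 → x ∈ I) (n : ℕ) :
    μ (incrementEvent I N n) ≤
      ENNReal.ofReal (8 * (N + 2) * Real.exp (3 / 2)) * ENNReal.ofReal (1 / 2) ^ n := by
  have h4 : (0 : ℝ≥0) < (4 ^ (n + 1) : ℕ) := by positivity
  have hterm : ∀ j ≤ (N + 1) * 4 ^ (n + 1), μ {f | ((n : ℝ) + 1) / 2 ^ n <
      |pathVal f (j / (4 ^ (n + 1) : ℕ)) - pathVal f ((j / 4 * 4 : ℕ) / (4 ^ (n + 1) : ℕ))|} ≤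
      ENNReal.ofReal (2 * (Real.exp (3 / 2) * (1 / 8) ^ n)) := by
    intro j hj
    have hle := Nat.div_mul_le_self j 4
    have hc : (j : ℝ≥0) / (4 ^ (n + 1) : ℕ) - (j / 4 * 4 : ℕ) / (4 ^ (n + 1) : ℕ) ≤
        ((4 : ℝ≥0) ^ n)⁻¹ := by
      rw [tsub_le_iff_left, inv_eq_one_div, ← mul_div_mul_left (1 : ℝ≥0) (4 ^ n) four_ne_zero,
        ← pow_succ', Nat.cast_pow, Nat.cast_ofNat, ← add_div]
      gcongr
      have : j ≤ j / 4 * 4 + 4 := by omega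
      rw [mul_one]
      exact_mod_cast this
    have h := hμ.measure_increment_le (hNI _ (div_le_of_le_mul_nat (by positivity) (hle.trans hj)))
      (hNI _ (div_le_of_le_mul_nat (by positivity) hj)) (by gcongr) hc
      (ε := ((n : ℝ) + 1) / 2 ^ n) (by positivity)
    refine h.trans (ENNReal.ofReal_le_ofReal ?_)
    have hexp : -(((n : ℝ) + 1) / 2 ^ n) ^ 2 / (2 * (((4 : ℝ≥0) ^ n)⁻¹ : ℝ≥0)) =
        -((n : ℝ) + 1) ^ 2 / 2 := by
      have : ((2 : ℝ) ^ n) ^ 2 = 4 ^ n := by rw [← pow_mul, mul_comm, pow_mul]; norm_num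
      push_cast
      rw [div_pow, this]
      field_simp
    rw [hexp]
    have := exp_neg_sq_le n
    linarith
  have hsub : incrementEvent I N n ⊆ ⋃ j ∈ Finset.range ((N + 1) * 4 ^ (n + 1) + 1),
      {f | ((n : ℝ) + 1) / 2 ^ n < |pathVal f (j / (4 ^ (n + 1) : ℕ)) -
        pathVal f ((j / 4 * 4 : ℕ) / (4 ^ (n + 1) : ℕ))|} := by
    rintro f ⟨j, hj, hf⟩
    simp only [Set.mem_iUnion]
    exact ⟨j, Finset.mem_range.2 (by omega), hf⟩
  refine (measure_mono hsub).trans ((measure_biUnion_finset_le _ _).trans ?_)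
  refine (Finset.sum_le_card_nsmul _ _ _ fun j hj =>
    hterm j (Nat.lt_succ_iff.1 (Finset.mem_range.1 hj))).trans ?_
  rw [Finset.card_range, nsmul_eq_mul, ← ENNReal.ofReal_natCast,
    ← ENNReal.ofReal_mul (by positivity), ← ENNReal.ofReal_pow (by norm_num),
    ← ENNReal.ofReal_mul (by positivity)]
  refine ENNReal.ofReal_le_ofReal ?_
  have h1 : (((N + 1) * 4 ^ (n + 1) + 1 : ℕ) : ℝ) ≤ (N + 2) * (4 * 4 ^ n) := by
    have : (1 : ℝ) ≤ 4 ^ n := one_le_pow₀ (by norm_num)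
    push_cast
    rw [pow_succ]
    linarith
  have h2 : (4 : ℝ) ^ n * (1 / 8) ^ n = (1 / 2) ^ n := by rw [← mul_pow]; norm_num
  calc _ ≤ (N + 2) * (4 * 4 ^ n) * (2 * (Real.exp (3 / 2) * (1 / 8) ^ n)) := by gcongr
    _ = 8 * (N + 2) * Real.exp (3 / 2) * ((4 : ℝ) ^ n * (1 / 8) ^ n) := by ring
    _ = _ := by rw [h2]

/-! ### Counting short programs -/

theorem exists_finset_length_le (K : ℕ) : ∃ S : Finset (List Bool), S.card ≤ 2 ^ (K + 1) ∧
    ∀ p : List Bool, p.length ≤ K → p ∈ S := by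
  refine ⟨(Finset.range (K + 1)).biUnion fun l =>
    (Finset.univ : Finset (List.Vector Bool l)).image List.Vector.toList, ?_, fun p hp => ?_⟩
  · refine Finset.card_biUnion_le.trans ?_
    calc _ ≤ ∑ l ∈ Finset.range (K + 1), 2 ^ l := by
          refine Finset.sum_le_sum fun l _ => Finset.card_image_le.trans ?_
          simp
      _ ≤ 2 ^ (K + 1) := (Nat.geomSum_lt le_rfl (by simp)).le
  · simp only [Finset.mem_biUnion, Finset.mem_range, Finset.mem_image, Finset.mem_univ, true_and]
    exact ⟨p.length, by omega, ⟨p, rfl⟩, rfl⟩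

theorem two_pow_div_le {q K n : ℕ} (hq : 0 < q) (hK : 2 * q * K + 2 * n ≤ q * n) :
    (2 : ℝ) ^ K / 2 ^ (n / 2) ≤ 2 * ((2 : ℝ) ^ (-(1 / q : ℝ))) ^ n := by
  have hq' : (0 : ℝ) < q := by exact_mod_cast hq
  have hi : (n : ℝ) ≤ 2 * (n / 2 : ℕ) + 1 := by
    exact_mod_cast (by omega : n ≤ 2 * (n / 2) + 1)
  have hK' : 2 * (q : ℝ) * K + 2 * n ≤ q * n := by exact_mod_cast hK
  rw [← Real.rpow_natCast, ← Real.rpow_natCast, ← Real.rpow_sub two_pos, ← Real.rpow_natCast,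
    ← Real.rpow_mul two_pos.le]
  calc (2 : ℝ) ^ ((K : ℝ) - (n / 2 : ℕ)) ≤ 2 ^ (1 + -(1 / q : ℝ) * n) := by
        refine Real.rpow_le_rpow_of_exponent_le one_le_two ?_
        have : (K : ℝ) ≤ n / 2 - 1 / q * n := by
          field_simp
          linarith
        linarith
    _ = _ := by rw [Real.rpow_add two_pos, Real.rpow_one]

/-- Weakening the rate from `r` to `√r` absorbs the linear factor, leaving the purely geometric
bound needed for a test. -/
theorem exists_add_mul_pow_le {r : ℝ} (h0 : 0 < r) (h1 : r < 1) :
    ∃ C : ℝ, 0 ≤ C ∧ ∀ n : ℕ, ((n : ℝ) + 5) * r ^ n ≤ C * √r ^ n := by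
  have hs0 : 0 < √r := Real.sqrt_pos.2 h0
  have hs1 : √r < 1 := by rw [Real.sqrt_lt' one_pos]; simpa using h1
  have ht := (tendsto_self_mul_const_pow_of_lt_one hs0.le hs1).add
    ((tendsto_pow_atTop_nhds_zero_of_lt_one hs0.le hs1).const_mul 5)
  obtain ⟨C, hC⟩ := ht.bddAbove_range
  refine ⟨max C 0, le_max_right _ _, fun n => ?_⟩
  have hCn : (n : ℝ) * √r ^ n + 5 * √r ^ n ≤ C := hC ⟨n, rfl⟩
  calc ((n : ℝ) + 5) * r ^ n = (n * √r ^ n + 5 * √r ^ n) * √r ^ n := by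
        nth_rewrite 1 [← Real.mul_self_sqrt h0.le]
        rw [mul_pow]; ring
    _ ≤ max C 0 * √r ^ n := by
        gcongr
        exact hCn.trans (le_max_left _ _)

theorem IsWienerMeasure.exists_measure_smallValueEvent_le (hμ : IsWienerMeasure μ)
    (U : List Bool →. List Bool) {N : ℕ} (hNI : ∀ x : ℝ≥0, x ≤ N + 1 → x ∈ I) (R k : ℕ) {q : ℕ}
    (hq : 2 ≤ q) : ∃ C ρ : ℝ≥0∞, C ≠ ⊤ ∧ ρ < 1 ∧
      ∀ n, μ (smallValueEvent I U N R q k n) ≤ C * ρ ^ n := by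
  have hq0 : (0 : ℝ) < q := by positivity
  set r : ℝ := (2 : ℝ) ^ (-(1 / q : ℝ))
  have hr0 : 0 < r := Real.rpow_pos_of_pos two_pos _
  have hr1 : r < 1 := Real.rpow_lt_one_of_one_lt_of_neg one_lt_two (by
    rw [neg_lt_zero]; positivity)
  obtain ⟨C, hC0, hC⟩ := exists_add_mul_pow_le hr0 hr1
  refine ⟨ENNReal.ofReal (8 * R * C), ENNReal.ofReal √r, ENNReal.ofReal_ne_top, ?_, fun n => ?_⟩
  · rw [ENNReal.ofReal_lt_one, Real.sqrt_lt' one_pos]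
    simpa using hr1
  set D : ℝ := (2 * (n / 2 : ℕ) + 5) / 2 ^ (n / 2) with hD
  have hD0 : 0 ≤ D := by positivity
  obtain ⟨K, hK, hKmax⟩ : ∃ K, 2 * q * K + 2 * n ≤ q * n ∧
      ∀ l, 2 * q * l + 2 * n ≤ q * n → l ≤ K := by
    have h2 : 2 * n ≤ q * n := Nat.mul_le_mul_right n hq
    refine ⟨(q * n - 2 * n) / (2 * q), ?_, fun l hl => ?_⟩
    · have := Nat.mul_div_le (q * n - 2 * n) (2 * q)
      omega
    · rw [Nat.le_div_iff_mul_le (by positivity), mul_comm]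
      omega
  obtain ⟨S, hScard, hS⟩ := exists_finset_length_le K
  have hsub : smallValueEvent I U N R q k n ⊆ ⋃ p ∈ S, {f | ∃ σ : List Bool, σ ∈ U p ∧
      dyadicNumerator k σ / 2 ^ (n % 2) ≤ (N + 1) * 4 ^ (n / 2) ∧
      4 ^ (n / 2) ≤ dyadicNumerator k σ / 2 ^ (n % 2) * R ∧
      |pathVal f ((dyadicNumerator k σ / 2 ^ (n % 2) : ℕ) / (4 ^ (n / 2) : ℕ))| < D} := by
    rintro f ⟨p, σ, hσ, hpn, -, h1, h2, h3⟩
    simp only [Set.mem_iUnion]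
    exact ⟨p, hS p (hKmax _ hpn), σ, hσ, h1, h2, h3⟩
  have hterm : ∀ p ∈ S, μ {f | ∃ σ : List Bool, σ ∈ U p ∧
      dyadicNumerator k σ / 2 ^ (n % 2) ≤ (N + 1) * 4 ^ (n / 2) ∧
      4 ^ (n / 2) ≤ dyadicNumerator k σ / 2 ^ (n % 2) * R ∧
      |pathVal f ((dyadicNumerator k σ / 2 ^ (n % 2) : ℕ) / (4 ^ (n / 2) : ℕ))| < D} ≤
      R * ENNReal.ofReal (2 * D) := by
    intro p _
    -- A program has at most one output, so each `p` contributes the event of a small value at a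
    -- single time, or nothing.
    by_cases hσ : ∃ σ : List Bool, σ ∈ U p ∧
      dyadicNumerator k σ / 2 ^ (n % 2) ≤ (N + 1) * 4 ^ (n / 2) ∧
      4 ^ (n / 2) ≤ dyadicNumerator k σ / 2 ^ (n % 2) * R
    · obtain ⟨σ, hσU, h1, h2⟩ := hσ
      have h4 : 0 < 4 ^ (n / 2) := by positivity
      refine le_trans (measure_mono ?_) (hμ.measure_value_le (hNI 0 zero_le)
        (hNI _ (div_le_of_le_mul_nat h4 h1)) (R := R) ?_ D)
      · rintro f ⟨σ', hσ', -, -, h3⟩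
        rwa [Part.mem_unique hσ' hσU] at h3
      · rw [div_mul_eq_mul_div, one_le_div (by exact_mod_cast h4)]
        exact_mod_cast h2
    · rw [show {f : C(I, ℝ) | ∃ σ : List Bool, σ ∈ U p ∧
        dyadicNumerator k σ / 2 ^ (n % 2) ≤ (N + 1) * 4 ^ (n / 2) ∧
        4 ^ (n / 2) ≤ dyadicNumerator k σ / 2 ^ (n % 2) * R ∧
        |pathVal f ((dyadicNumerator k σ / 2 ^ (n % 2) : ℕ) / (4 ^ (n / 2) : ℕ))| < D} = ∅ from
        Set.eq_empty_of_forall_notMem fun f ⟨σ, h1, h2, h3, _⟩ => hσ ⟨σ, h1, h2, h3⟩]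
      simp
  refine (measure_mono hsub).trans ((measure_biUnion_finset_le _ _).trans
    ((Finset.sum_le_card_nsmul _ _ _ hterm).trans ?_))
  rw [nsmul_eq_mul, ← ENNReal.ofReal_natCast, ← ENNReal.ofReal_natCast,
    ← ENNReal.ofReal_mul (by positivity), ← ENNReal.ofReal_mul (by positivity),
    ← ENNReal.ofReal_pow (by positivity), ← ENNReal.ofReal_mul (by positivity)]
  refine ENNReal.ofReal_le_ofReal ?_
  have hScard' : (S.card : ℝ) ≤ 2 * 2 ^ K := by
    rw [← pow_succ']; exact_mod_cast hScard
  have hi : (2 * (n / 2 : ℕ) + 5 : ℝ) ≤ n + 5 := by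
    have : (2 * (n / 2) : ℕ) ≤ n := by omega
    have : ((2 * (n / 2) : ℕ) : ℝ) ≤ n := by exact_mod_cast this
    push_cast at this ⊢
    linarith
  calc (S.card : ℝ) * (R * (2 * D)) ≤ 2 * 2 ^ K * (R * (2 * D)) := by gcongr
    _ = 4 * R * (2 * (n / 2 : ℕ) + 5) * (2 ^ K / 2 ^ (n / 2)) := by rw [hD]; ring
    _ ≤ 4 * R * (n + 5) * (2 * r ^ n) := by
        gcongr
        exact two_pow_div_le (by omega) hK
    _ = 8 * R * ((n + 5) * r ^ n) := by ring
    _ ≤ 8 * R * (C * √r ^ n) := mul_le_mul_of_nonneg_left (hC n) (by positivity)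
    _ = 8 * R * C * √r ^ n := by ring

end Wiener

/-! ### Dyadic approximations of a real number -/

/-- The largest multiple of `4⁻ⁿ` which is at most `t`. -/
def gridFloor (t : ℝ≥0) (n : ℕ) : ℝ≥0 :=
  (⌊t * 4 ^ n⌋₊ : ℝ≥0) / (4 ^ n : ℕ)

theorem gridFloor_le (t : ℝ≥0) (n : ℕ) : gridFloor t n ≤ t := by
  rw [gridFloor, Nat.cast_pow, Nat.cast_ofNat, div_le_iff₀ (by positivity)]
  exact Nat.floor_le zero_le

theorem floor_mul_le {N : ℕ} {t : ℝ≥0} (ht : t ≤ N + 1) (n : ℕ) :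
    ⌊t * 4 ^ n⌋₊ ≤ (N + 1) * 4 ^ n := by
  refine Nat.floor_le_of_le ?_
  push_cast
  gcongr

theorem tendsto_gridFloor (t : ℝ≥0) : Tendsto (gridFloor t) atTop (nhds t) := by
  rw [← NNReal.tendsto_coe]
  have h4 : Tendsto (fun n : ℕ => (t : ℝ) - (1 / 4) ^ n) atTop (nhds t) := by
    simpa using (tendsto_pow_atTop_nhds_zero_of_lt_one (r := (1 / 4 : ℝ)) (by norm_num)
      (by norm_num)).const_sub (t : ℝ)
  refine tendsto_of_tendsto_of_tendsto_of_le_of_le h4 tendsto_const_nhds (fun n => ?_)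
    fun n => by exact_mod_cast gridFloor_le t n
  have h := (Nat.lt_floor_add_one (t * 4 ^ n)).le
  have h' : (t : ℝ) * 4 ^ n ≤ ⌊t * 4 ^ n⌋₊ + 1 := by exact_mod_cast h
  dsimp only
  rw [gridFloor, NNReal.coe_div, one_div, inv_pow, sub_le_iff_le_add]
  push_cast
  rw [← one_div, ← add_div, le_div_iff₀ (by positivity)]
  exact h'

theorem floor_div_four (t : ℝ≥0) (n : ℕ) : ⌊t * 4 ^ (n + 1)⌋₊ / 4 = ⌊t * 4 ^ n⌋₊ := by
  have := Nat.floor_div_natCast (t * 4 ^ (n + 1)) 4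
  rw [← this]
  congr 1
  rw [pow_succ, ← mul_assoc]
  push_cast
  exact mul_div_cancel_right₀ _ (by norm_num)

theorem dyadicNumerator_digits (t : ℝ≥0) (n : ℕ) :
    dyadicNumerator ⌊t⌋₊ ((List.range n).map (binaryDigits t)) = ⌊t * 2 ^ n⌋₊ := by
  induction n with
  | zero => simp [dyadicNumerator]
  | succ n ih =>
    unfold dyadicNumerator at ih ⊢
    rw [List.range_succ, List.map_append, List.foldl_append, ih]
    have h1 : ⌊t * 2 ^ (n + 1)⌋₊ / 2 = ⌊t * 2 ^ n⌋₊ := by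
      rw [← Nat.floor_div_natCast (t * 2 ^ (n + 1)) 2]
      congr 1
      rw [pow_succ, ← mul_assoc]
      push_cast
      exact mul_div_cancel_right₀ _ (by norm_num)
    have h2 : ⌊(t : ℝ) * 2 ^ (n + 1)⌋ = (⌊t * 2 ^ (n + 1)⌋₊ : ℤ) := by
      rw [Int.floor_eq_iff]
      have e1 := Nat.floor_le (zero_le (a := t * 2 ^ (n + 1)))
      have e2 := Nat.lt_floor_add_one (t * 2 ^ (n + 1))
      constructor
      · exact_mod_cast e1
      · exact_mod_cast e2
    simp only [List.map_cons, List.map_nil, List.foldl_cons, List.foldl_nil, binaryDigits, h2]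
    rcases Nat.mod_two_eq_zero_or_one ⌊t * 2 ^ (n + 1)⌋₊ with h | h
    · rw [decide_eq_false (by omega)]
      simp only [Bool.toNat_false]
      omega
    · rw [decide_eq_true (by omega)]
      simp only [Bool.toNat_true]
      omega

/-- The grid is in base `4`, so for odd `n` the last binary digit is dropped. -/
theorem dyadicNumerator_digits_div (t : ℝ≥0) (n : ℕ) :
    dyadicNumerator ⌊t⌋₊ ((List.range n).map (binaryDigits t)) / 2 ^ (n % 2) =
      ⌊t * 4 ^ (n / 2)⌋₊ := by
  have := Nat.floor_div_natCast (t * 2 ^ n) (2 ^ (n % 2))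
  rw [dyadicNumerator_digits, ← this]
  congr 1
  have h2 : (2 : ℝ≥0) ^ n = 4 ^ (n / 2) * 2 ^ (n % 2) := by
    conv_lhs => rw [← Nat.div_add_mod n 2]
    rw [pow_add, pow_mul]
    norm_num
  rw [h2, ← mul_assoc, Nat.cast_pow, Nat.cast_ofNat]
  exact mul_div_cancel_right₀ _ (by positivity)

/-! ### Chaining -/

theorem abs_pathVal_gridFloor_le {I : Set ℝ≥0} {N : ℕ} (hNI : ∀ x : ℝ≥0, x ≤ N + 1 → x ∈ I)
    {f : C(I, ℝ)} {M : ℕ} (hf : ∀ n ≥ M, f ∉ incrementEvent I N n) {t : ℝ≥0} (ht : t ≤ N + 1)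
    (hft : pathVal f t = 0) {n : ℕ} (hn : M ≤ n) :
    |pathVal f (gridFloor t n)| ≤ (2 * n + 4) / 2 ^ n := by
  have hstep : ∀ m ≥ M, |pathVal f (gridFloor t (m + 1)) - pathVal f (gridFloor t m)| ≤
      ((m : ℝ) + 1) / 2 ^ m := by
    intro m hm
    by_contra! hlt
    refine hf m hm ⟨⌊t * 4 ^ (m + 1)⌋₊, floor_mul_le ht _, ?_⟩
    have : gridFloor t m =
        (⌊t * 4 ^ (m + 1)⌋₊ / 4 * 4 : ℕ) / (4 ^ (m + 1) : ℕ) := by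
      rw [floor_div_four, gridFloor, pow_succ, Nat.cast_mul, Nat.cast_mul]
      exact (mul_div_mul_right _ _ (by norm_num)).symm
    rw [← this]
    exact hlt
  have hsum : ∀ l, |pathVal f (gridFloor t (n + l)) - pathVal f (gridFloor t n)| ≤
      (2 * (n : ℝ) + 4) / 2 ^ n - (2 * ((n + l : ℕ) : ℝ) + 4) / 2 ^ (n + l) := by
    intro l
    induction l with
    | zero => simp
    | succ l ih =>
      have h1 := hstep (n + l) (by omega)
      -- The function `(2 * m + 4) / 2 ^ m` is the tail sum of `(m + 1) / 2 ^ m`, so the bounds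
      -- telescope.
      have h2 : ((n + l : ℕ) + 1 : ℝ) / 2 ^ (n + l) = (2 * ((n + l : ℕ) : ℝ) + 4) / 2 ^ (n + l) -
          (2 * ((n + l + 1 : ℕ) : ℝ) + 4) / 2 ^ (n + l + 1) := by
        rw [pow_succ]
        push_cast
        field_simp
        ring
      rw [h2] at h1
      have h3 := abs_sub_le (pathVal f (gridFloor t (n + l + 1))) (pathVal f (gridFloor t (n + l)))
        (pathVal f (gridFloor t n))
      rw [← add_assoc n l 1]
      linarith
  have hmem : ∀ l, gridFloor t l ∈ I := fun l => hNI _ ((gridFloor_le t l).trans ht)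
  have htend : Tendsto (fun l => pathVal f (gridFloor t (n + l))) atTop (nhds 0) := by
    rw [← hft]
    simp only [pathVal_of_mem f (hmem _), pathVal_of_mem f (hNI _ ht)]
    refine (f.continuous.tendsto ⟨t, hNI _ ht⟩).comp (tendsto_subtype_rng.2 ?_)
    exact (tendsto_gridFloor t).comp (tendsto_atTop_mono (fun l => Nat.le_add_left l n) tendsto_id)
  have hlim := (htend.sub_const (pathVal f (gridFloor t n))).abs
  rw [zero_sub, abs_neg] at hlim
  refine le_of_tendsto hlim (Eventually.of_forall fun l => (hsum l).trans ?_)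
  have : (0 : ℝ) ≤ (2 * ((n + l : ℕ) : ℝ) + 4) / 2 ^ (n + l) := by positivity
  linarith

/-! ### Compressible initial segments -/

theorem frequently_exists_short_program {U : List Bool →. List Bool} {X : ℕ → Bool}
    (h : seqEffDim U X < 1 / 2) : ∃ q : ℕ, 2 ≤ q ∧ ∃ᶠ n in atTop, ∃ p : List Bool,
      (List.range n).map X ∈ U p ∧ 2 * q * p.length + 2 * n ≤ q * n := by
  obtain ⟨b, hb, hb2⟩ := exists_between h
  have hbt : b ≠ ⊤ := (hb2.trans_le le_top).ne
  lift b to ℝ≥0 using hbt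
  have hb2' : (b : ℝ) < 1 / 2 := by
    have h1 : b < 1 / 2 := by
      rw [← ENNReal.coe_lt_coe]
      simpa using hb2
    exact_mod_cast h1
  obtain ⟨q, hq⟩ := exists_nat_one_div_lt (sub_pos.2 hb2')
  have hq0 : (0 : ℝ) < (q : ℝ) + 1 := by positivity
  -- From `b < 1/2 - 1/(q + 1)` follows `b ≤ 1/2 - 1/(q + 2)`; the shift also secures `2 ≤ q + 2`.
  refine ⟨q + 2, by omega, ?_⟩
  refine ((frequently_lt_of_liminf_lt (by isBoundedDefault) hb).and_eventually
    (eventually_gt_atTop 0)).mono ?_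
  rintro n ⟨hn, hn0⟩
  rw [ENNReal.div_lt_iff (Or.inl (by exact_mod_cast hn0.ne')) (Or.inl (ENNReal.natCast_ne_top n))]
    at hn
  obtain ⟨p, hp, hpn⟩ : ∃ p : List Bool, (List.range n).map X ∈ U p ∧
      (p.length : ℝ≥0∞) < b * n := by
    by_contra! hcon
    refine hn.not_ge ?_
    have hfin : ((b * n : ℝ≥0) : ℝ≥0∞) = b * n := by push_cast; rfl
    have hle : ((⌈b * n⌉₊ : ℕ) : ℕ∞) ≤ complexity U ((List.range n).map X) := by
      refine le_iInf₂ fun p hp => ?_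
      have := hcon p hp
      rw [← hfin] at this
      have h' : b * n ≤ p.length := by exact_mod_cast this
      exact_mod_cast Nat.ceil_le.2 h'
    calc (b : ℝ≥0∞) * n = ((b * n : ℝ≥0) : ℝ≥0∞) := hfin.symm
      _ ≤ ((⌈b * n⌉₊ : ℕ) : ℝ≥0∞) := by exact_mod_cast Nat.le_ceil (b * n)
      _ ≤ _ := by exact_mod_cast ENat.toENNReal_le.2 hle
  refine ⟨p, hp, ?_⟩
  have h1 : (p.length : ℝ) < b * n := by
    have : ((p.length : ℝ≥0) : ℝ≥0∞) < ((b * n : ℝ≥0) : ℝ≥0∞) := by push_cast; exact hpn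
    exact_mod_cast ENNReal.coe_lt_coe.1 this
  have hn' : (0 : ℝ) < n := by exact_mod_cast hn0
  have h2 : (2 * ((q : ℝ) + 2) * p.length + 2 * n) ≤ (q + 2) * n := by
    rw [div_lt_iff₀ hq0] at hq
    have h3 : 2 * ((q : ℝ) + 2) * b + 2 ≤ q + 2 := by nlinarith [b.coe_nonneg]
    nlinarith
  exact_mod_cast h2

theorem exists_nat_le_gridFloor_mul {t : ℝ≥0} (ht : t ≠ 0) :
    ∃ R : ℕ, ∀ᶠ i in atTop, 4 ^ i ≤ ⌊t * 4 ^ i⌋₊ * R := by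
  have ht0 : 0 < t := pos_iff_ne_zero.2 ht
  obtain ⟨R, hR⟩ := exists_nat_gt (t / 2)⁻¹
  refine ⟨R, ((tendsto_gridFloor t).eventually (lt_mem_nhds (NNReal.half_lt_self ht))).mono ?_⟩
  intro i hi
  have h4 : (0 : ℝ≥0) < (4 ^ i : ℕ) := by positivity
  have h1 : 1 ≤ gridFloor t i * R := by
    calc 1 = (t / 2) * (t / 2)⁻¹ := (mul_inv_cancel₀ (by positivity)).symm
      _ ≤ gridFloor t i * R := by gcongr
  rw [gridFloor, div_mul_eq_mul_div, one_le_div h4] at h1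
  exact_mod_cast h1

theorem half_le_effDim {I : Set ℝ≥0} (hI : I = Set.Icc 0 1 ∨ I = Set.univ)
    {μ : Measure C(I, ℝ)} (hμ : IsWienerMeasure μ) {U : List Bool →. List Bool} (hU : Partrec U)
    {B : C(I, ℝ)} (hB : IsMLRandom μ B) {N : ℕ} (hNI : ∀ x : ℝ≥0, x ≤ N + 1 → x ∈ I)
    {t : ℝ≥0} (ht : t ≤ N + 1) (ht0 : t ≠ 0) (hBt : pathVal B t = 0) :
    1 / 2 ≤ effDim U (t : ℝ) := by
  by_contra! hlt
  obtain ⟨q, hq, hfreq⟩ := frequently_exists_short_program hlt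
  obtain ⟨R, hR⟩ := exists_nat_le_gridFloor_mul ht0
  -- The digits omit the integer part of `t`, so `⌊t⌋₊` is built into the test as a constant.
  obtain ⟨C, ρ, hC, hρ, hsmall⟩ :=
    hμ.exists_measure_smallValueEvent_le U hNI R ⌊t⌋₊ hq
  obtain ⟨M₁, hM₁⟩ := hB.exists_forall_notMem (incrementEvent_effectivelyOpen hI hNI)
    ENNReal.ofReal_ne_top (ENNReal.ofReal_lt_one.2 one_half_lt_one)
    (hμ.measure_incrementEvent_le hNI)
  obtain ⟨M₂, hM₂⟩ := hB.exists_forall_notMem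
    (smallValueEvent_effectivelyOpen hI hU hNI R q ⌊t⌋₊) hC hρ hsmall
  have hhalf : Tendsto (fun n : ℕ => n / 2) atTop atTop :=
    Nat.tendsto_div_const_atTop two_ne_zero
  obtain ⟨n, ⟨p, hp, hpn⟩, hn₂, hn₁, hnR⟩ := (hfreq.and_eventually
    ((eventually_ge_atTop M₂).and ((hhalf.eventually (eventually_ge_atTop M₁)).and
      (hhalf.eventually hR)))).exists
  refine hM₂ n hn₂ ⟨p, _, hp, hpn, by simp, ?_⟩
  rw [dyadicNumerator_digits_div]
  refine ⟨floor_mul_le ht _, hnR, ?_⟩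
  -- Chaining gives a non-strict bound with `4`; the `5` in `smallValueEvent` makes it strict, as
  -- openness requires.
  refine (abs_pathVal_gridFloor_le hNI hM₁ ht hBt hn₁).trans_lt ?_
  gcongr
  norm_num

end MLBrownian

end

theorem mainTheorem2 (I : Set ℝ≥0) (hI : I = Set.Icc 0 1 ∨ I = Set.univ)
    (μ : Measure C(I, ℝ)) (hμ : MLBrownian.IsWienerMeasure μ)
    (U : List Bool →. List Bool) (hU : MLBrownian.IsOptimalPrefixFreeMachine U)
    (B : C(I, ℝ)) (hB : MLBrownian.IsMLRandom μ B) :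
    ∀ t ∈ MLBrownian.zeroSet B \ {0}, (1 / 2 : ℝ≥0∞) ≤ MLBrownian.effDim U (t : ℝ) := by
  rintro t ⟨⟨htI, hBt⟩, ht0⟩
  obtain ⟨N, hNI, htN⟩ : ∃ N : ℕ, (∀ x : ℝ≥0, x ≤ N + 1 → x ∈ I) ∧ t ≤ N + 1 := by
    rcases hI with rfl | rfl
    · exact ⟨0, fun x hx => ⟨zero_le, by simpa using hx⟩, by simpa using htI.2⟩
    · exact ⟨⌊t⌋₊, fun _ _ => trivial, (Nat.lt_floor_add_one t).le⟩
  exact MLBrownian.half_le_effDim hI hμ hU.partrec hB hNI htN ht0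
    ((MLBrownian.pathVal_of_mem B htI).trans hBt)
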